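/- Let $n\ge 0$ be an integer. For $b=(b_1,\ldots,b_n)\in\mathbb{R}^n$ let $$g_b=\bigl(x^{2n}+1\bigr)+b_1\bigl(x^{2n-1}+x\bigr)+\cdots+b_{n-1}\bigl(x^{n+1}+x^{n-1}\bigr)+b_nx^n\in\mathbb{R}[x],$$ and let $V_n$ be the set of those $b\in\mathbb{R}^n$ such that all complex roots of $g_b$ lie on the unit circle (for $n=0$ we read $g_b$ as the constant $2$, so that $V_0=\mathbb{R}^0$ is a single point, of volume $1$). Then $V_n$ is Borel measurable, and its volume ($n$-dimensional Lebesgue measure) $v_n$ is given by $$v_n=\frac{2^{n(n+1)}}{n!}\prod_{1\le i<j\le n}\frac{j-i}{j+i}=\frac{2^n}{n!}\prod_{j=1}^n\left(\frac{2j}{2j-1}\right)^{n+1-j}.$$ -/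

import Mathlib

open Polynomial in
/-- The palindromic polynomial
`g_b = (x^{2n} + 1) + b₁ (x^{2n-1} + x) + ⋯ + b_{n-1} (x^{n+1} + x^{n-1}) + b_n x^n`.
The coefficient `b_k` of the text is `b i` with `k = i + 1`. -/
noncomputable def palindromicPoly (n : ℕ) (b : Fin n → ℝ) : ℝ[X] :=
  (X ^ (2 * n) + 1) +
    ∑ i : Fin n,
      if (i : ℕ) + 1 = n then C (b i) * X ^ n
      else C (b i) * (X ^ (2 * n - ((i : ℕ) + 1)) + X ^ ((i : ℕ) + 1))

/-- The region `V_n ⊆ ℝⁿ`: those `b` for which all complex roots of `g_b` lie on the unit circle. -/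
def unitCircleRegion (n : ℕ) : Set (Fin n → ℝ) :=
  {b | ∀ z : ℂ, Polynomial.aeval z (palindromicPoly n b) = 0 → ‖z‖ = 1}

/-!
Write `w = z + z⁻¹`. Then `g_b(z) = z ^ n * p_b(w)`, where `p_b` is the monic polynomial of degree
`n` whose lower coordinates in the basis `1, C₁, C₂, …` with `C_k(z + z⁻¹) = z ^ k + z⁻¹ ^ k` are
the entries of `b`, and `‖z‖ = 1` exactly when `w ∈ [-2, 2]`. Hence `V_n` is the image of the cube
`[-2, 2]ⁿ` under the symmetric map sending the roots `x` of a monic polynomial to its coordinates.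
As the `C_k` are monic, the Jacobian of this map is, as for the elementary symmetric functions, the
Vandermonde determinant `Δ` up to sign, so `vol V_n = (1 / n!) ∫ |Δ|`. Rescaling the cube to
`[0, 1]ⁿ` gives a Selberg integral with exponent `1 / 2`, which is evaluated by Aomoto's recursion:
integrating by parts in one variable relates the moments of `e_k(x) |Δ(x)|` for successive `k`.
-/

open MeasureTheory Set

section PermutationInvariance

theorem preimage_comp_perm_Icc {ι β : Type*} [Preorder β] (a b : β) (σ : Equiv.Perm ι) :
    (· ∘ σ) ⁻¹' Icc (fun _ => a) (fun _ => b) = Icc (fun _ : ι => a) fun _ => b := by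
  ext x
  simp only [mem_preimage, mem_Icc, Pi.le_def, Function.comp_apply]
  rw [σ.forall_congr_right (q := fun i => a ≤ x i), σ.forall_congr_right (q := fun i => x i ≤ b)]

theorem measurableEmbedding_comp_perm {ι α : Type*} [MeasurableSpace α] (σ : Equiv.Perm ι) :
    MeasurableEmbedding fun x : ι → α => x ∘ σ :=
  (MeasurableEquiv.arrowCongr' σ.symm (MeasurableEquiv.refl α)).measurableEmbedding

variable {ι α : Type*} [Fintype ι] [MeasureSpace α] [SigmaFinite (volume : Measure α)]

theorem measurePreserving_comp_perm (σ : Equiv.Perm ι) :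
    MeasurePreserving fun x : ι → α => x ∘ σ :=
  volume_preserving_arrowCongr' σ.symm (MeasurableEquiv.refl α) (.id _)

theorem setIntegral_comp_perm {E : Type*} [NormedAddCommGroup E] [NormedSpace ℝ E]
    {K : Set (ι → α)} {σ : Equiv.Perm ι} (hK : (· ∘ σ) ⁻¹' K = K) (F : (ι → α) → E) :
    ∫ x in K, F (x ∘ σ) = ∫ x in K, F x := by
  conv_lhs => rw [← hK]
  exact (measurePreserving_comp_perm σ).setIntegral_preimage_emb
    (measurableEmbedding_comp_perm σ) F K

theorem setLIntegral_comp_perm {K : Set (ι → α)} {σ : Equiv.Perm ι} (hK : (· ∘ σ) ⁻¹' K = K)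
    (g : (ι → α) → ENNReal) : ∫⁻ x in K, g (x ∘ σ) = ∫⁻ x in K, g x := by
  conv_lhs => rw [← hK]
  exact (measurePreserving_comp_perm σ).setLIntegral_comp_preimage_emb
    (measurableEmbedding_comp_perm σ) g K

end PermutationInvariance

section Ordering

variable {n : ℕ}

theorem volume_setOf_not_injective {ι : Type*} [Fintype ι] :
    volume {x : ι → ℝ | ¬Function.Injective x} = 0 := by
  have hsub : {x : ι → ℝ | ¬Function.Injective x} ⊆
      ⋃ p : {p : ι × ι // p.1 ≠ p.2}, ((LinearMap.proj (R := ℝ) (φ := fun _ : ι => ℝ) p.1.1 -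
          LinearMap.proj p.1.2).ker : Set (ι → ℝ)) := by
    intro x hx
    obtain ⟨i, j, hij, hne⟩ := Function.not_injective_iff.1 hx
    exact mem_iUnion.2 ⟨⟨(i, j), hne⟩, by simp [hij]⟩
  refine measure_mono_null hsub (measure_iUnion_null fun ⟨(i, j), hij⟩ => ?_)
  classical
  refine Measure.addHaar_submodule _ _ fun htop => ?_
  have hsingle := htop ▸ Submodule.mem_top (x := (Pi.single i 1 : ι → ℝ))
  simp [hij.symm] at hsingle

theorem measurableSet_strictMono : MeasurableSet {x : Fin n → ℝ | StrictMono x} := by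
  simp only [StrictMono, ofPred_forall]
  exact .iInter fun i => .iInter fun j => .iInter fun _ =>
    measurableSet_lt (measurable_pi_apply i) (measurable_pi_apply j)

theorem strictMono_comp_sort {α : Type*} [LinearOrder α] {x : Fin n → α}
    (hx : Function.Injective x) : StrictMono (x ∘ Tuple.sort x) :=
  (Tuple.monotone_sort x).strictMono_of_injective (hx.comp (Tuple.sort x).injective)

theorem sum_indicator_strictMono_comp_perm {α M : Type*} [LinearOrder α] [AddCommMonoid M]
    {g : (Fin n → α) → M} (hg : ∀ (σ : Equiv.Perm (Fin n)) x, g (x ∘ σ) = g x) {x : Fin n → α}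
    (hx : Function.Injective x) :
    ∑ σ : Equiv.Perm (Fin n), {x | StrictMono x}.indicator g (x ∘ σ) = g x := by
  rw [Finset.sum_eq_single (Tuple.sort x)]
  · rw [indicator_of_mem (by exact strictMono_comp_sort hx), hg]
  · refine fun σ _ hσ => indicator_of_notMem (fun hmono => hσ ?_) g
    have hcomp : x ∘ σ = x ∘ Tuple.sort x := by
      rw [← StrictMono.range_inj hmono (strictMono_comp_sort hx)]
      simp only [EquivLike.range_comp]
    exact Equiv.ext fun i => hx (congrFun hcomp i)
  · simp

theorem setLIntegral_eq_factorial_mul_strictMono {K : Set (Fin n → ℝ)}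
    (hK : ∀ σ : Equiv.Perm (Fin n), (· ∘ σ) ⁻¹' K = K) {g : (Fin n → ℝ) → ENNReal}
    (hm : Measurable g) (hg : ∀ (σ : Equiv.Perm (Fin n)) x, g (x ∘ σ) = g x) :
    ∫⁻ x in K, g x = n.factorial * ∫⁻ x in {x | StrictMono x} ∩ K, g x := by
  have hinj : ∀ᵐ x ∂(volume : Measure (Fin n → ℝ)).restrict K, Function.Injective x :=
    ae_restrict_of_ae volume_setOf_not_injective
  have hind : ∀ σ ∈ Finset.univ, Measurable fun x : Fin n → ℝ =>
      {x | StrictMono x}.indicator g (x ∘ (σ : Equiv.Perm (Fin n))) := fun σ _ =>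
    (hm.indicator measurableSet_strictMono).comp (measurePreserving_comp_perm σ).measurable
  calc ∫⁻ x in K, g x
      = ∫⁻ x in K, ∑ σ : Equiv.Perm (Fin n), {x | StrictMono x}.indicator g (x ∘ σ) :=
        lintegral_congr_ae (hinj.mono fun x hx => (sum_indicator_strictMono_comp_perm hg hx).symm)
    _ = ∑ σ : Equiv.Perm (Fin n), ∫⁻ x in K, {x | StrictMono x}.indicator g x := by
        rw [lintegral_finsetSum _ hind]
        exact Finset.sum_congr rfl fun σ _ => setLIntegral_comp_perm (hK σ) _
    _ = n.factorial * ∫⁻ x in {x | StrictMono x} ∩ K, g x := by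
        rw [lintegral_indicator measurableSet_strictMono,
          Measure.restrict_restrict measurableSet_strictMono]
        simp only [Finset.sum_const, Finset.card_univ, Fintype.card_perm, Fintype.card_fin,
          nsmul_eq_mul]

end Ordering

section Vandermonde

variable {n : ℕ}

/-- The absolute value `∏_{i < j} |x j - x i|` of the Vandermonde determinant, which is the
Jacobian of the passage from the roots of a monic polynomial to its coefficients. -/
noncomputable def absVandermonde (x : Fin n → ℝ) : ℝ :=
  |(Matrix.vandermonde x).det|

theorem absVandermonde_nonneg (x : Fin n → ℝ) : 0 ≤ absVandermonde x := abs_nonneg _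

theorem absVandermonde_ne_zero {x : Fin n → ℝ} (hx : Function.Injective x) :
    absVandermonde x ≠ 0 :=
  abs_ne_zero.2 (Matrix.det_vandermonde_ne_zero_iff.2 hx)

@[fun_prop]
theorem continuous_absVandermonde : Continuous (absVandermonde : (Fin n → ℝ) → ℝ) := by
  unfold absVandermonde
  simp only [Matrix.det_vandermonde]
  fun_prop

theorem absVandermonde_comp_perm (σ : Equiv.Perm (Fin n)) (x : Fin n → ℝ) :
    absVandermonde (x ∘ σ) = absVandermonde x :=
  Matrix.abs_det_submatrix_equiv_equiv σ (.refl _) (Matrix.vandermonde x)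

theorem absVandermonde_add_const (x : Fin n → ℝ) (c : ℝ) :
    absVandermonde (fun i => x i + c) = absVandermonde x := by
  rw [absVandermonde, Matrix.det_vandermonde_add, absVandermonde]

theorem absVandermonde_smul (r : ℝ) (x : Fin n → ℝ) :
    absVandermonde (r • x) = |r| ^ n.choose 2 * absVandermonde x := by
  have hmul : Matrix.vandermonde (r • x) =
      Matrix.vandermonde x * Matrix.diagonal fun j : Fin n => r ^ (j : ℕ) := by
    ext i j
    rw [Matrix.mul_diagonal, Matrix.vandermonde_apply, Matrix.vandermonde_apply, Pi.smul_apply,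
      smul_eq_mul, mul_pow, mul_comm]
  rw [absVandermonde, hmul, Matrix.det_mul, Matrix.det_diagonal, Finset.prod_pow_eq_pow_sum,
    Fin.sum_univ_eq_sum_range (fun j => j), Finset.sum_range_id, ← Nat.choose_two_right,
    abs_mul, abs_pow, mul_comm, absVandermonde]

theorem absVandermonde_cons (t : ℝ) (y : Fin n → ℝ) :
    absVandermonde (Fin.cons t y : Fin (n + 1) → ℝ) = (∏ j, |t - y j|) * absVandermonde y := by
  simp only [absVandermonde, Matrix.det_vandermonde, Fin.prod_univ_succ, Fin.prod_Ioi_zero,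
    Fin.prod_Ioi_succ, abs_mul, Finset.abs_prod, Fin.cons_zero, Fin.cons_succ, abs_sub_comm t]

theorem absVandermonde_mul_self (x : Fin n → ℝ) :
    absVandermonde x * absVandermonde x = |∏ i, ∏ j ∈ Finset.univ.erase i, (x i - x j)| := by
  have hdiag := Finset.prod_prod_Ioi_mul_eq_prod_prod_off_diag (fun i j : Fin n => |x j - x i|)
  simp only [Finset.prod_mul_distrib] at hdiag
  simp only [absVandermonde, Matrix.det_vandermonde, Finset.abs_prod, ← Finset.compl_singleton]
  rw [← hdiag]
  simp only [abs_sub_comm]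

/-- The term `|Δ x| / (x 0 - x (j + 1))` contributed by `j` to the partial derivative of the
absolute Vandermonde `|Δ x|` in `x 0`; it vanishes where `x 0 = x (j + 1)`. -/
noncomputable def vandermondeQuot (j : Fin n) (x : Fin (n + 1) → ℝ) : ℝ :=
  absVandermonde x / (x 0 - x j.succ)

theorem sub_mul_vandermondeQuot (j : Fin n) (x : Fin (n + 1) → ℝ) :
    (x 0 - x j.succ) * vandermondeQuot j x = absVandermonde x := by
  refine mul_div_cancel_of_imp' fun hsub => ?_
  rw [absVandermonde, abs_eq_zero, Matrix.det_vandermonde_eq_zero_iff]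
  exact ⟨0, j.succ, sub_eq_zero.1 hsub, (Fin.succ_ne_zero j).symm⟩

theorem vandermondeQuot_comp_swap (j : Fin n) (x : Fin (n + 1) → ℝ) :
    vandermondeQuot j (x ∘ Equiv.swap 0 j.succ) = -vandermondeQuot j x := by
  simp only [vandermondeQuot, absVandermonde_comp_perm, Function.comp_apply,
    Equiv.swap_apply_left, Equiv.swap_apply_right]
  rw [← neg_sub, div_neg]

theorem abs_vandermondeQuot_le (j : Fin n) (x : Fin (n + 1) → ℝ) :
    |vandermondeQuot j x| ≤
      (∏ i ∈ Finset.univ.erase j, |x 0 - x i.succ|) * absVandermonde (Fin.tail x) := by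
  induction x using Fin.consCases with | _ t y
  rw [vandermondeQuot, abs_div, abs_of_nonneg (absVandermonde_nonneg _), absVandermonde_cons]
  simp only [Fin.cons_zero, Fin.cons_succ, Fin.tail_cons]
  rw [← Finset.mul_prod_erase _ _ (Finset.mem_univ j), mul_assoc]
  refine div_le_of_le_mul₀ (abs_nonneg _) ?_ (mul_comm _ _).le
  exact mul_nonneg (Finset.prod_nonneg fun _ _ => abs_nonneg _) (absVandermonde_nonneg _)

theorem hasDerivAt_absVandermonde_cons {t : ℝ} {y : Fin n → ℝ} (ht : t ∉ range y) :
    HasDerivAt (fun s => absVandermonde (Fin.cons s y : Fin (n + 1) → ℝ))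
      (∑ j, vandermondeQuot j (Fin.cons t y)) t := by
  simp only [absVandermonde_cons]
  have hne : ∀ j, t - y j ≠ 0 := fun j hj => ht ⟨j, (sub_eq_zero.1 hj).symm⟩
  have habs : ∀ j, HasDerivAt (fun s => |s - y j|) (SignType.sign (t - y j) : ℝ) t := fun j =>
    (hasDerivAt_abs (hne j)).comp_sub_const t (y j)
  refine ((HasDerivAt.fun_finsetProd fun j _ => habs j).mul_const _).congr_deriv ?_
  rw [Finset.sum_mul]
  refine Finset.sum_congr rfl fun j _ => ?_
  rw [vandermondeQuot, Fin.cons_zero, Fin.cons_succ, eq_div_iff (hne j), absVandermonde_cons,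
    ← Finset.mul_prod_erase _ _ (Finset.mem_univ j), ← sign_mul_self (t - y j), smul_eq_mul]
  ring

end Vandermonde

section IntegrationByParts

variable {n : ℕ}

theorem integrableOn_mul_vandermondeQuot (j : Fin n) {K : Set (Fin (n + 1) → ℝ)}
    (hK : IsCompact K) {F : (Fin (n + 1) → ℝ) → ℝ} (hF : Continuous F) :
    IntegrableOn (fun x => F x * vandermondeQuot j x) K := by
  have hmeas : Measurable (vandermondeQuot j) := by
    have := continuous_absVandermonde (n := n + 1)
    unfold vandermondeQuot
    fun_prop
  have hbound : Continuous fun x : Fin (n + 1) → ℝ =>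
      |F x| * ((∏ i ∈ Finset.univ.erase j, |x 0 - x i.succ|) * absVandermonde (Fin.tail x)) := by
    fun_prop
  refine (hbound.continuousOn.integrableOn_compact hK).mono'
    (hF.measurable.mul hmeas).aestronglyMeasurable (.of_forall fun x => ?_)
  rw [norm_mul, Real.norm_eq_abs, Real.norm_eq_abs]
  exact mul_le_mul_of_nonneg_left (abs_vandermondeQuot_le j x) (abs_nonneg _)

theorem setIntegral_mul_vandermondeQuot (j : Fin n) {K : Set (Fin (n + 1) → ℝ)}
    (hK : IsCompact K) (hswap : (· ∘ Equiv.swap 0 j.succ) ⁻¹' K = K)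
    {F G : (Fin (n + 1) → ℝ) → ℝ} (hF : Continuous F)
    (hG : ∀ x, F x - F (x ∘ Equiv.swap 0 j.succ) = (x 0 - x j.succ) * G x) :
    ∫ x in K, F x * vandermondeQuot j x = (∫ x in K, G x * absVandermonde x) / 2 := by
  have hFswap : Continuous fun x : Fin (n + 1) → ℝ => F (x ∘ Equiv.swap 0 j.succ) :=
    hF.comp (continuous_pi fun i => continuous_apply _)
  have hinvol : ∫ x in K, F (x ∘ Equiv.swap 0 j.succ) * vandermondeQuot j x =
      -∫ x in K, F x * vandermondeQuot j x := by
    rw [← setIntegral_comp_perm hswap fun x => F x * vandermondeQuot j x, ← integral_neg]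
    simp only [vandermondeQuot_comp_swap, mul_neg, neg_neg]
  have hdiff : ∫ x in K, G x * absVandermonde x = ∫ x in K, F x * vandermondeQuot j x -
      F (x ∘ Equiv.swap 0 j.succ) * vandermondeQuot j x := by
    congr with x
    rw [← sub_mul, hG, ← sub_mul_vandermondeQuot j x]
    ring
  rw [hdiff, integral_sub (integrableOn_mul_vandermondeQuot j hK hF)
    (integrableOn_mul_vandermondeQuot j hK hFswap), hinvol]
  ring

theorem piFinSuccAbove_zero_symm_eq_cons :
    ⇑(MeasurableEquiv.piFinSuccAbove (fun _ : Fin (n + 1) => ℝ) 0).symm =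
      fun p => Fin.cons p.1 p.2 := by
  funext p
  exact Fin.insertNth_zero (α := fun _ => ℝ) p.1 p.2

theorem measurableEmbedding_cons :
    MeasurableEmbedding fun p : ℝ × (Fin n → ℝ) => (Fin.cons p.1 p.2 : Fin (n + 1) → ℝ) :=
  piFinSuccAbove_zero_symm_eq_cons ▸ MeasurableEquiv.measurableEmbedding _

theorem measurePreserving_cons_restrict_Icc (a b : Fin (n + 1) → ℝ) :
    MeasurePreserving (fun p : ℝ × (Fin n → ℝ) => (Fin.cons p.1 p.2 : Fin (n + 1) → ℝ))
      ((volume.restrict (Icc (a 0) (b 0))).prod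
        (volume.restrict (Icc (Fin.tail a) (Fin.tail b))))
      (volume.restrict (Icc a b)) := by
  have hpre : (fun p : ℝ × (Fin n → ℝ) => (Fin.cons p.1 p.2 : Fin (n + 1) → ℝ)) ⁻¹' Icc a b =
      Icc (a 0) (b 0) ×ˢ Icc (Fin.tail a) (Fin.tail b) := by
    ext p
    simp only [mem_preimage, mem_prod, mem_Icc, Fin.le_cons, Fin.cons_le]
    tauto
  rw [Measure.prod_restrict, ← hpre]
  have hvol := (volume_preserving_piFinSuccAbove (fun _ : Fin (n + 1) => ℝ) 0).symm
  rw [piFinSuccAbove_zero_symm_eq_cons] at hvol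
  exact hvol.restrict_preimage_emb measurableEmbedding_cons _

theorem setIntegral_Icc_cons {a b : Fin (n + 1) → ℝ} {F : (Fin (n + 1) → ℝ) → ℝ}
    (hF : IntegrableOn F (Icc a b)) :
    ∫ x in Icc a b, F x =
      ∫ y in Icc (Fin.tail a) (Fin.tail b), ∫ t in Icc (a 0) (b 0), F (Fin.cons t y) := by
  have hcons := measurePreserving_cons_restrict_Icc a b
  rw [← hcons.integral_comp measurableEmbedding_cons]
  exact integral_prod_symm _ ((hcons.integrable_comp_emb measurableEmbedding_cons).2 hF)

theorem ae_integrableOn_cons {a b : Fin (n + 1) → ℝ} {F : (Fin (n + 1) → ℝ) → ℝ}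
    (hF : IntegrableOn F (Icc a b)) :
    ∀ᵐ y ∂volume.restrict (Icc (Fin.tail a) (Fin.tail b)),
      IntegrableOn (fun t => F (Fin.cons t y)) (Icc (a 0) (b 0)) :=
  (((measurePreserving_cons_restrict_Icc a b).integrable_comp_emb
    measurableEmbedding_cons).2 hF).prod_left_ae

theorem setIntegral_Icc_deriv_mul_absVandermonde {a b : Fin (n + 1) → ℝ} (hab : a 0 ≤ b 0)
    {F F' : (Fin (n + 1) → ℝ) → ℝ} (hF : Continuous F) (hF' : Continuous F')
    (hderiv : ∀ y t, HasDerivAt (fun s => F (Fin.cons s y)) (F' (Fin.cons t y)) t) :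
    (∫ x in Icc a b, F' x * absVandermonde x) +
        ∑ j, ∫ x in Icc a b, F x * vandermondeQuot j x =
      ∫ y in Icc (Fin.tail a) (Fin.tail b),
        F (Fin.cons (b 0) y) * absVandermonde (Fin.cons (b 0) y : Fin (n + 1) → ℝ) -
          F (Fin.cons (a 0) y) * absVandermonde (Fin.cons (a 0) y : Fin (n + 1) → ℝ) := by
  have hquot : ∀ j : Fin n, IntegrableOn (fun x => F x * vandermondeQuot j x) (Icc a b) := fun j =>
    integrableOn_mul_vandermondeQuot j isCompact_Icc hF
  have hvand : IntegrableOn (fun x => F' x * absVandermonde x) (Icc a b) :=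
    Continuous.integrableOn_Icc (by fun_prop)
  have hsum : IntegrableOn (fun x => F' x * absVandermonde x +
      ∑ j, F x * vandermondeQuot j x) (Icc a b) :=
    hvand.add (integrable_finsetSum _ fun j _ => hquot j)
  rw [← integral_finsetSum _ fun j _ => hquot j,
    ← integral_add hvand (integrable_finsetSum _ fun j _ => hquot j), setIntegral_Icc_cons hsum]
  refine integral_congr_ae ((ae_integrableOn_cons hsum).mono fun y hy => ?_)
  have hcons : Continuous fun s : ℝ => (Fin.cons s y : Fin (n + 1) → ℝ) :=
    continuous_id.finCons (A := fun _ => ℝ) continuous_const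
  rw [← intervalIntegrable_iff_integrableOn_Icc_of_le hab] at hy
  dsimp only
  rw [integral_Icc_eq_integral_Ioc, ← intervalIntegral.integral_of_le hab]
  refine integral_eq_of_hasDerivAt_off_countable_of_le
    (fun t => F (Fin.cons t y) * absVandermonde (Fin.cons t y : Fin (n + 1) → ℝ)) _ hab
    (countable_range y)
    ((hF.comp hcons).mul (continuous_absVandermonde.comp hcons)).continuousOn
    (fun t ht => ?_) hy
  exact ((hderiv y t).mul (hasDerivAt_absVandermonde_cons ht.2)).congr_deriv
    (by rw [Finset.mul_sum])

theorem setIntegral_Icc_aomoto {a b : ℝ} (hab : a ≤ b)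
    {F F' : (Fin (n + 1) → ℝ) → ℝ} {G : Fin n → (Fin (n + 1) → ℝ) → ℝ}
    (hF : Continuous F) (hF' : Continuous F')
    (hderiv : ∀ y t, HasDerivAt (fun s => F (Fin.cons s y)) (F' (Fin.cons t y)) t)
    (hG : ∀ j x, F x - F (x ∘ Equiv.swap 0 j.succ) = (x 0 - x j.succ) * G j x) :
    (∫ x in Icc (fun _ => a) (fun _ => b), F' x * absVandermonde x) +
        (∑ j, ∫ x in Icc (fun _ => a) (fun _ => b), G j x * absVandermonde x) / 2 =
      ∫ y in Icc (fun _ => a) (fun _ => b),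
        F (Fin.cons b y) * absVandermonde (Fin.cons b y : Fin (n + 1) → ℝ) -
          F (Fin.cons a y) * absVandermonde (Fin.cons a y : Fin (n + 1) → ℝ) := by
  rw [Finset.sum_div]
  simp only [← setIntegral_mul_vandermondeQuot _ isCompact_Icc (preimage_comp_perm_Icc a b _) hF
    (hG _)]
  exact setIntegral_Icc_deriv_mul_absVandermonde hab hF hF' hderiv

end IntegrationByParts

section Selberg

/-- The Selberg-type moment `∫ (∏ i ∈ S, x i) |Δ x|` over the cube `[0, 1]ⁿ`, computed by Aomoto's
recursion on `S`. -/
noncomputable def vandermondeMoment {n : ℕ} (S : Finset (Fin n)) : ℝ :=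
  ∫ x in Icc (fun _ => 0) (fun _ => 1), (∏ i ∈ S, x i) * absVandermonde x

theorem prod_comp_swap_of_notMem {ι M : Type*} [DecidableEq ι] [CommMonoid M] {S : Finset ι}
    {a b : ι} (ha : a ∉ S) (hb : b ∉ S) (x : ι → M) :
    ∏ i ∈ S, (x ∘ Equiv.swap a b) i = ∏ i ∈ S, x i :=
  Finset.prod_congr rfl fun i hi => by
    rw [Function.comp_apply, Equiv.swap_apply_of_ne_of_ne (ne_of_mem_of_not_mem hi ha)
      (ne_of_mem_of_not_mem hi hb)]

variable {n : ℕ}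

theorem vandermondeMoment_empty :
    vandermondeMoment (∅ : Finset (Fin n)) =
      ∫ x in Icc (fun _ : Fin n => (0 : ℝ)) (fun _ => 1), absVandermonde x := by
  simp only [vandermondeMoment, Finset.prod_empty, one_mul]

theorem vandermondeMoment_insert_eq_insert {S : Finset (Fin n)} {a b : Fin n} (ha : a ∉ S)
    (hb : b ∉ S) : vandermondeMoment (insert a S) = vandermondeMoment (insert b S) := by
  rw [vandermondeMoment, ← setIntegral_comp_perm (preimage_comp_perm_Icc _ _ (Equiv.swap a b))]
  simp only [absVandermonde_comp_perm, Finset.prod_insert ha, prod_comp_swap_of_notMem ha hb,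
    (Function.comp_apply : (_ ∘ Equiv.swap a b) a = _), Equiv.swap_apply_left, vandermondeMoment,
    Finset.prod_insert hb]

theorem integrableOn_prod_mul_absVandermonde (S : Finset (Fin n)) {K : Set (Fin n → ℝ)}
    (hK : IsCompact K) : IntegrableOn (fun x => (∏ i ∈ S, x i) * absVandermonde x) K :=
  Continuous.continuousOn (by fun_prop) |>.integrableOn_compact hK

theorem setIntegral_one_sub_sub_mul_prod_mul_absVandermonde {S : Finset (Fin n)} {a b : Fin n}
    (ha : a ∉ S) (hb : b ∉ S) :
    ∫ x in Icc (fun _ => 0) (fun _ => 1), (1 - x a - x b) * (∏ i ∈ S, x i) * absVandermonde x =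
      vandermondeMoment S - 2 * vandermondeMoment (insert a S) := by
  have hint := fun T : Finset (Fin n) => integrableOn_prod_mul_absVandermonde T
    (isCompact_Icc (a := fun _ => 0) (b := fun _ => 1))
  have hexpand : ∀ x : Fin n → ℝ, (1 - x a - x b) * (∏ i ∈ S, x i) * absVandermonde x =
      (∏ i ∈ S, x i) * absVandermonde x - (∏ i ∈ insert a S, x i) * absVandermonde x -
        (∏ i ∈ insert b S, x i) * absVandermonde x := fun x => by
    rw [Finset.prod_insert ha, Finset.prod_insert hb]
    ring
  simp only [hexpand]
  rw [integral_sub (by exact (hint _).sub (hint _)) (hint _), integral_sub (hint _) (hint _),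
    two_mul, ← sub_sub]
  nth_rw 2 [vandermondeMoment_insert_eq_insert ha hb]
  rfl

theorem sum_ite_succ_mem_const {S : Finset (Fin (n + 1))} (h0 : 0 ∉ S) (A B : ℝ) :
    ∑ j : Fin n, (if j.succ ∈ S then A else B) = S.card * A + (n - S.card) * B := by
  have hsum := Fin.sum_univ_succ fun i => if i ∈ S then A else B
  have hcard := Finset.card_compl_add_card S
  rw [Fintype.card_fin] at hcard
  rw [if_neg h0, Finset.sum_ite, Finset.filter_mem_eq_inter, Finset.univ_inter,
    Finset.filter_notMem_eq_sdiff, ← Finset.compl_eq_univ_sdiff, Finset.sum_const,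
    Finset.sum_const, nsmul_eq_mul, nsmul_eq_mul] at hsum
  have hcard' : (Sᶜ.card : ℝ) + S.card = n + 1 := mod_cast hcard
  linear_combination B * hcard' - hsum

theorem aomoto_swap_diff {S : Finset (Fin (n + 1))} (h0 : 0 ∉ S) (j : Fin n)
    (x : Fin (n + 1) → ℝ) :
    (x 0 - x 0 ^ 2) * (∏ i ∈ S, x i) -
        ((x ∘ Equiv.swap 0 j.succ) 0 - (x ∘ Equiv.swap 0 j.succ) 0 ^ 2) *
          ∏ i ∈ S, (x ∘ Equiv.swap 0 j.succ) i =
      (x 0 - x j.succ) * if j.succ ∈ S then -∏ i ∈ insert 0 S, x i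
        else (1 - x 0 - x j.succ) * ∏ i ∈ S, x i := by
  split_ifs with hj
  · have hrest := prod_comp_swap_of_notMem (fun h => h0 (Finset.mem_of_mem_erase h))
      (Finset.notMem_erase j.succ S) x
    rw [Finset.prod_insert h0, ← Finset.mul_prod_erase S _ hj, ← Finset.mul_prod_erase S _ hj,
      hrest]
    simp only [Function.comp_apply, Equiv.swap_apply_left, Equiv.swap_apply_right]
    ring
  · rw [prod_comp_swap_of_notMem h0 hj, Function.comp_apply, Equiv.swap_apply_left]
    ring

theorem prod_cons_of_zero_notMem {S : Finset (Fin (n + 1))} (h0 : 0 ∉ S) (s t : ℝ)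
    (y : Fin n → ℝ) :
    ∏ i ∈ S, (Fin.cons s y : Fin (n + 1) → ℝ) i = ∏ i ∈ S, (Fin.cons t y : Fin (n + 1) → ℝ) i :=
  Finset.prod_congr rfl fun i hi => by
    obtain ⟨j, rfl⟩ := Fin.exists_succ_eq.2 (ne_of_mem_of_not_mem hi h0)
    rw [Fin.cons_succ, Fin.cons_succ]

theorem vandermondeMoment_insert_zero {S : Finset (Fin (n + 1))} (h0 : 0 ∉ S) :
    vandermondeMoment (insert 0 S) * (2 * n + 4 - S.card) =
      vandermondeMoment S * (n + 2 - S.card) := by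
  have haomoto := setIntegral_Icc_aomoto zero_le_one (F := fun x => (x 0 - x 0 ^ 2) * ∏ i ∈ S, x i)
    (F' := fun x => (1 - x 0 - x 0) * ∏ i ∈ S, x i) (by fun_prop) (by fun_prop)
    (fun y t => by
      simp only [fun s => prod_cons_of_zero_notMem h0 s 0 y, Fin.cons_zero]
      refine (((hasDerivAt_id' t).fun_sub (hasDerivAt_pow 2 t)).congr_deriv ?_).mul_const _
      ring)
    (aomoto_swap_diff h0)
  have hterm : ∀ j : Fin n, ∫ x in Icc (fun _ => 0) (fun _ => 1),
      (if j.succ ∈ S then -∏ i ∈ insert 0 S, x i else (1 - x 0 - x j.succ) * ∏ i ∈ S, x i) *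
        absVandermonde x =
      if j.succ ∈ S then -vandermondeMoment (insert 0 S)
        else vandermondeMoment S - 2 * vandermondeMoment (insert 0 S) := fun j => by
    split_ifs with hj
    · simp only [neg_mul, integral_neg, vandermondeMoment]
    · exact setIntegral_one_sub_sub_mul_prod_mul_absVandermonde h0 hj
  simp only [hterm, setIntegral_one_sub_sub_mul_prod_mul_absVandermonde h0 h0,
    sum_ite_succ_mem_const h0, Fin.cons_zero, one_pow, sub_self, zero_pow two_ne_zero, zero_mul,
    integral_zero] at haomoto
  linear_combination -2 * haomoto

theorem vandermondeMoment_insert {S : Finset (Fin n)} {a : Fin n} (ha : a ∉ S) :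
    vandermondeMoment (insert a S) * (2 * n + 2 - S.card) =
      vandermondeMoment S * (n + 1 - S.card) := by
  cases n with
  | zero => exact a.elim0
  | succ n =>
    push_cast
    by_cases h0 : 0 ∈ S
    · obtain ⟨R, hR, rfl⟩ : ∃ R, 0 ∉ R ∧ insert 0 R = S :=
        ⟨S.erase 0, Finset.notMem_erase 0 S, Finset.insert_erase h0⟩
      rw [Finset.mem_insert, not_or] at ha
      have h0' : 0 ∉ insert a R := by simp [hR, Ne.symm ha.1]
      have hrec := vandermondeMoment_insert_zero h0'
      rw [Finset.insert_comm, Finset.card_insert_of_notMem ha.2,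
        ← vandermondeMoment_insert_eq_insert hR ha.2] at hrec
      rw [Finset.card_insert_of_notMem hR]
      linear_combination hrec
    · rw [vandermondeMoment_insert_eq_insert ha h0]
      linear_combination vandermondeMoment_insert_zero h0

theorem vandermondeMoment_eq_descFactorial_div (S : Finset (Fin n)) :
    vandermondeMoment S =
      (n + 1).descFactorial S.card / (2 * n + 2).descFactorial S.card *
        vandermondeMoment (∅ : Finset (Fin n)) := by
  induction S using Finset.induction_on with
  | empty => simp
  | insert a S ha ih =>
    have hcard : S.card ≤ n := (Finset.card_le_univ S).trans_eq (Fintype.card_fin n)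
    have hpos : (0 : ℝ) < 2 * n + 2 - S.card := by
      have : (S.card : ℝ) ≤ n := mod_cast hcard
      linarith [(n.cast_nonneg : (0 : ℝ) ≤ n)]
    rw [Finset.card_insert_of_notMem ha, Nat.descFactorial_succ, Nat.descFactorial_succ,
      eq_div_of_mul_eq hpos.ne' (vandermondeMoment_insert ha), ih, Nat.cast_mul, Nat.cast_mul,
      Nat.cast_sub (by lia), Nat.cast_sub (by lia)]
    push_cast
    rw [mul_div_mul_comm]
    ring

theorem vandermondeMoment_univ :
    vandermondeMoment (Finset.univ : Finset (Fin n)) =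
      (n + 2) / 2 / (2 * n + 1).choose n * vandermondeMoment (∅ : Finset (Fin n)) := by
  have hchoose : ((2 * n + 1).choose n * (2 * n + 2) : ℝ) = (2 * n + 2).choose n * (n + 2) := by
    have := Nat.choose_mul_succ_eq (2 * n + 1) n
    rw [show 2 * n + 1 + 1 - n = n + 2 by lia] at this
    exact_mod_cast this
  have hpos : (0 : ℝ) < (2 * n + 1).choose n := mod_cast Nat.choose_pos (by lia)
  have hpos' : (0 : ℝ) < (2 * n + 2).choose n := mod_cast Nat.choose_pos (by lia)
  rw [vandermondeMoment_eq_descFactorial_div, Finset.card_univ, Fintype.card_fin,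
    Nat.descFactorial_eq_factorial_mul_choose, Nat.descFactorial_eq_factorial_mul_choose,
    Nat.choose_succ_self_right]
  congr 1
  push_cast
  field_simp
  linear_combination hchoose

theorem vandermondeMoment_empty_succ :
    vandermondeMoment (∅ : Finset (Fin (n + 1))) * ((n + 2) / 2) =
      vandermondeMoment (Finset.univ : Finset (Fin n)) := by
  have haomoto := setIntegral_Icc_aomoto (n := n) zero_le_one (F := fun x => x 0 - 1)
    (F' := fun _ => 1) (G := fun _ _ => 1) (by fun_prop) (by fun_prop)
    (fun y t => by simpa only [Fin.cons_zero] using (hasDerivAt_id' t).sub_const 1)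
    (fun j x => by rw [Function.comp_apply, Equiv.swap_apply_left]; ring)
  have hboundary : ∫ y in Icc (fun _ : Fin n => (0 : ℝ)) (fun _ => 1),
      (1 - 1) * absVandermonde (Fin.cons 1 y : Fin (n + 1) → ℝ) -
        (0 - 1) * absVandermonde (Fin.cons 0 y : Fin (n + 1) → ℝ) =
      vandermondeMoment (Finset.univ : Finset (Fin n)) :=
    setIntegral_congr_fun measurableSet_Icc fun y hy => by
      have habs : ∀ j, |0 - y j| = y j := fun j => by
        rw [zero_sub, abs_neg, abs_of_nonneg (hy.1 j)]
      simp only [absVandermonde_cons 0, habs]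
      ring
  simp only [Fin.cons_zero, one_mul, ← vandermondeMoment_empty, Finset.sum_const, Finset.card_univ,
    Fintype.card_fin, nsmul_eq_mul] at haomoto
  rw [← hboundary, ← haomoto]
  ring

theorem vandermondeMoment_empty_succ_eq_div_choose :
    vandermondeMoment (∅ : Finset (Fin (n + 1))) =
      vandermondeMoment (∅ : Finset (Fin n)) / (2 * n + 1).choose n := by
  have hrec := vandermondeMoment_empty_succ (n := n)
  rw [vandermondeMoment_univ] at hrec
  have hpos : (0 : ℝ) < (n + 2) / 2 := by positivity
  refine mul_right_cancel₀ hpos.ne' (hrec.trans ?_)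
  ring

end Selberg

theorem prod_Ico_sub_div_add (n : ℕ) :
    ∏ i ∈ Finset.Ico 1 (n + 1), (((n + 1 : ℕ) : ℝ) - i) / ((n + 1 : ℕ) + i) =
      ((2 * n + 1).choose n : ℝ)⁻¹ := by
  have hnum : ∏ i ∈ Finset.range n, (((n + 1 : ℕ) : ℝ) - (1 + i : ℕ)) = n.factorial := by
    rw [← Nat.descFactorial_self, Nat.descFactorial_eq_prod_range, Nat.cast_prod]
    refine Finset.prod_congr rfl fun i hi => ?_
    rw [Nat.cast_sub (Finset.mem_range.1 hi).le]
    push_cast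
    ring
  have hden : ∏ i ∈ Finset.range n, (((n + 1 : ℕ) : ℝ) + (1 + i : ℕ)) =
      n.factorial * (2 * n + 1).choose n := by
    rw [show 2 * n + 1 = n + 1 + n by ring, ← Nat.cast_mul,
      ← Nat.ascFactorial_eq_factorial_mul_choose, Nat.ascFactorial_eq_prod_range, Nat.cast_prod]
    refine Finset.prod_congr rfl fun i _ => ?_
    push_cast
    ring
  rw [Finset.prod_Ico_eq_prod_range, Nat.add_sub_cancel, Finset.prod_div_distrib, hnum, hden,
    div_mul_cancel_left₀ (mod_cast n.factorial_ne_zero)]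

theorem setIntegral_Icc_zero_one_absVandermonde (n : ℕ) :
    ∫ x in Icc (fun _ : Fin n => (0 : ℝ)) (fun _ => 1), absVandermonde x =
      ∏ j ∈ Finset.Icc 1 n, ∏ i ∈ Finset.Ico 1 j, ((j : ℝ) - i) / (j + i) := by
  rw [← vandermondeMoment_empty]
  induction n with
  | zero => simp [vandermondeMoment_empty, absVandermonde, Measure.real]
  | succ n ih =>
    rw [Finset.prod_Icc_succ_top (by lia), ← ih, vandermondeMoment_empty_succ_eq_div_choose,
      prod_Ico_sub_div_add, div_eq_mul_inv]

theorem preimage_smul_add_const_Icc {ι : Type*} {a b : ℝ} (hab : a < b) :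
    (fun x : ι → ℝ => (b - a) • x + fun _ => a) ⁻¹' Icc (fun _ => a) (fun _ => b) =
      Icc (fun _ => 0) (fun _ => 1) := by
  have hpos : 0 < b - a := sub_pos.2 hab
  refine Set.ext fun x => and_congr (forall_congr' fun i => ?_) (forall_congr' fun i => ?_)
  · exact (le_add_iff_nonneg_left a).trans (mul_nonneg_iff_of_pos_left hpos)
  · exact le_sub_iff_add_le.symm.trans (mul_le_iff_le_one_right hpos)

theorem setIntegral_Icc_eq_pow_mul_setIntegral_Icc_zero_one {ι : Type*} [Fintype ι] {a b : ℝ}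
    (hab : a < b) (f : (ι → ℝ) → ℝ) :
    ∫ x in Icc (fun _ => a) (fun _ => b), f x =
      (b - a) ^ Fintype.card ι *
        ∫ x in Icc (fun _ => 0) (fun _ => 1), f ((b - a) • x + fun _ => a) := by
  have hpos : 0 < (b - a) ^ Fintype.card ι := pow_pos (sub_pos.2 hab) _
  have hindicator :
      (Icc (fun _ => 0) fun _ => 1).indicator (fun x => f ((b - a) • x + fun _ => a)) = fun x =>
        (Icc (fun _ => a) fun _ => b).indicator f ((b - a) • x + fun _ => a) := by
    rw [← preimage_smul_add_const_Icc hab]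
    rfl
  rw [← integral_indicator measurableSet_Icc, ← integral_indicator measurableSet_Icc, hindicator,
    Measure.integral_comp_smul volume
      (fun x => (Icc (fun _ => a) fun _ => b).indicator f (x + fun _ => a)),
    integral_add_right_eq_self, Module.finrank_fintype_fun_eq_card, abs_of_pos (inv_pos.2 hpos),
    smul_eq_mul, mul_inv_cancel_left₀ hpos.ne']

theorem setIntegral_Icc_absVandermonde {a b : ℝ} (hab : a < b) (n : ℕ) :
    ∫ x in Icc (fun _ : Fin n => a) (fun _ => b), absVandermonde x =
      (b - a) ^ (n + 1).choose 2 *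
        ∏ j ∈ Finset.Icc 1 n, ∏ i ∈ Finset.Ico 1 j, ((j : ℝ) - i) / (j + i) := by
  have haffine : ∀ x : Fin n → ℝ, absVandermonde ((b - a) • x + fun _ => a) =
      (b - a) ^ n.choose 2 * absVandermonde x := fun x => by
    exact (absVandermonde_add_const _ a).trans
      (by rw [absVandermonde_smul, abs_of_pos (sub_pos.2 hab)])
  simp only [setIntegral_Icc_eq_pow_mul_setIntegral_Icc_zero_one hab, haffine,
    integral_const_mul, setIntegral_Icc_zero_one_absVandermonde, Fintype.card_fin, ← mul_assoc,
    ← pow_add, Nat.choose_succ_succ' n 1, Nat.choose_one_right]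

theorem prod_Icc_even_div_odd (n : ℕ) :
    ∏ j ∈ Finset.Icc 1 n, (2 * (j : ℝ) / (2 * j - 1)) = 4 ^ n / n.centralBinom := by
  induction n with
  | zero => simp
  | succ n ih =>
    have hrec : ((n + 1) * (n + 1).centralBinom : ℝ) = 2 * (2 * n + 1) * n.centralBinom := mod_cast
      n.succ_mul_centralBinom_succ
    have hpos : (0 : ℝ) < n.centralBinom := mod_cast n.centralBinom_pos
    have hpos' : (0 : ℝ) < (n + 1).centralBinom := mod_cast (n + 1).centralBinom_pos
    have hodd : (2 * ((n + 1 : ℕ) : ℝ) - 1) = 2 * n + 1 := by push_cast; ring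
    rw [Finset.prod_Icc_succ_top (by lia), ih, hodd]
    push_cast
    field_simp
    linear_combination 4 ^ n * 2 * hrec

theorem centralBinom_succ_eq_two_mul_choose (n : ℕ) :
    (n + 1).centralBinom = 2 * (2 * n + 1).choose n := by
  rw [Nat.centralBinom, Nat.mul_succ, Nat.choose_succ_succ', Nat.choose_symm_half, ← two_mul]

theorem two_pow_mul_prod_eq_prod_even_div_odd (n : ℕ) :
    (2 : ℝ) ^ (n * (n + 1)) *
        ∏ j ∈ Finset.Icc 1 n, ∏ i ∈ Finset.Ico 1 j, ((j : ℝ) - i) / (j + i) =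
      2 ^ n * ∏ j ∈ Finset.Icc 1 n, (2 * (j : ℝ) / (2 * j - 1)) ^ (n + 1 - j) := by
  induction n with
  | zero => simp
  | succ n ih =>
    have hexp : ∏ j ∈ Finset.Icc 1 (n + 1), (2 * (j : ℝ) / (2 * j - 1)) ^ (n + 1 + 1 - j) =
        (∏ j ∈ Finset.Icc 1 n, (2 * (j : ℝ) / (2 * j - 1)) ^ (n + 1 - j)) *
          ∏ j ∈ Finset.Icc 1 (n + 1), (2 * (j : ℝ) / (2 * j - 1)) := by
      rw [Finset.prod_Icc_succ_top (by lia), Finset.prod_Icc_succ_top (by lia), ← mul_assoc,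
        ← Finset.prod_mul_distrib]
      congr 1
      · refine Finset.prod_congr rfl fun j hj => ?_
        rw [← pow_succ, Nat.succ_sub (Nat.le_succ_of_le (Finset.mem_Icc.1 hj).2)]
      · rw [Nat.add_sub_cancel_left, pow_one]
    have hpow : (2 : ℝ) ^ ((n + 1) * (n + 1 + 1)) = 2 ^ (n * (n + 1)) * 4 ^ (n + 1) := by
      rw [show (4 : ℝ) = 2 ^ 2 by norm_num, ← pow_mul, ← pow_add]
      ring_nf
    rw [hexp, prod_Icc_even_div_odd, centralBinom_succ_eq_two_mul_choose,
      Finset.prod_Icc_succ_top (by lia), prod_Ico_sub_div_add, hpow]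
    push_cast
    linear_combination 4 ^ (n + 1) / ((2 * n + 1).choose n : ℝ) * ih

section RootMap

open Polynomial

section Coordinates

variable {R : Type*} [CommRing R] {S : Sequence R} {n : ℕ}

theorem degree_prod_X_sub_C [Nontrivial R] {ι : Type*} (s : Finset ι) (x : ι → R) :
    (∏ j ∈ s, (X - C (x j)) : R[X]).degree = s.card := by
  rw [degree_eq_natDegree (monic_prod_X_sub_C x s).ne_zero, natDegree_finsetProd_X_sub_C_eq_card]

/-- The monic polynomial of degree `n` whose lower coordinates with respect to `S` are `b`, listed
by decreasing degree. -/
noncomputable def monicOfCoords (S : Sequence R) (b : Fin n → R) : R[X] :=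
  S n + ∑ i, b i • S i.rev

theorem degree_sum_smul_lt (b : Fin n → R) : (∑ i, b i • S i.rev).degree < n := by
  rw [← mem_degreeLT]
  refine Submodule.sum_mem _ fun i _ => Submodule.smul_mem _ _ ?_
  rw [mem_degreeLT, S.degree_eq, Nat.cast_lt]
  exact i.rev.isLt

theorem monicOfCoords_monic (hS : ∀ i, (S i).Monic) (b : Fin n → R) : (monicOfCoords S b).Monic :=
  (hS n).add_of_left ((degree_sum_smul_lt b).trans_eq (S.degree_eq n).symm)

theorem natDegree_monicOfCoords (b : Fin n → R) : (monicOfCoords S b).natDegree = n := by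
  rw [monicOfCoords, natDegree_add_eq_left_of_degree_lt
    ((degree_sum_smul_lt b).trans_eq (S.degree_eq n).symm), S.natDegree_eq]

variable [IsDomain R] (hS : ∀ i, (S i).Monic)

/-- The basis of `R[X]` formed by a sequence of monic polynomials of degrees `0, 1, 2, …`. -/
noncomputable def monicBasis : Module.Basis ℕ R R[X] :=
  S.basis fun i => (hS i).isUnit_leadingCoeff_of_dvd dvd_rfl

theorem monicBasis_apply (i : ℕ) : monicBasis hS i = S i := Sequence.basis_eq_self S _ i

theorem sum_repr_monicBasis {p : R[X]} (hp : p.degree < n) :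
    ∑ i : Fin n, (monicBasis hS).repr p i.rev • S i.rev = p := by
  have hspan : p ∈ Submodule.span R (monicBasis hS '' Set.Iio n) := by
    rwa [funext (monicBasis_apply hS), S.span_degreeLT fun i _ => (hS i).isUnit_leadingCoeff_of_dvd
      dvd_rfl, mem_degreeLT]
  have hsupport : ((monicBasis hS).repr p).support ⊆ Finset.range n := fun i hi =>
    Finset.mem_range.2 ((monicBasis hS).mem_span_image.1 hspan hi)
  calc ∑ i : Fin n, (monicBasis hS).repr p i.rev • S i.rev
      = ∑ i : Fin n, (monicBasis hS).repr p i • S i :=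
        Equiv.sum_comp Fin.revPerm fun i : Fin n => (monicBasis hS).repr p i • S i
    _ = ∑ i ∈ Finset.range n, (monicBasis hS).repr p i • S i :=
        Fin.sum_univ_eq_sum_range (fun i => (monicBasis hS).repr p i • S i) n
    _ = p := by
        conv_rhs => rw [← (monicBasis hS).linearCombination_repr p,
          Finsupp.linearCombination_apply, Finsupp.sum_of_support_subset _ hsupport _ (by simp)]
        simp only [monicBasis_apply]

/-- The lower coordinates with respect to `S`, listed by decreasing degree, of the monic polynomial
with roots `x i`. -/
noncomputable def rootCoords (x : Fin n → R) : Fin n → R := fun i =>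
  (monicBasis hS).repr (∏ j, (X - C (x j))) i.rev

theorem repr_monicOfCoords (b : Fin n → R) (i : Fin n) :
    (monicBasis hS).repr (monicOfCoords S b) i.rev = b i := by
  have hbasis : ∀ k, (monicBasis hS).repr (S k) = Finsupp.single k 1 := fun k => by
    rw [← monicBasis_apply hS, Module.Basis.repr_self]
  simp only [monicOfCoords, map_add, map_sum, map_smul, hbasis, Finsupp.add_apply,
    Finsupp.finsetSum_apply, Finsupp.smul_apply, Finsupp.single_apply, smul_eq_mul, mul_ite,
    mul_one, mul_zero, Fin.val_inj, Fin.rev_inj, Finset.sum_ite_eq', Finset.mem_univ, if_true,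
    i.rev.isLt.ne', if_false, zero_add]

theorem monicOfCoords_rootCoords (x : Fin n → R) :
    monicOfCoords S (rootCoords hS x) = ∏ j, (X - C (x j)) := by
  have hdeg : (∏ j, (X - C (x j)) - S n : R[X]).degree < n := by
    have hprod : (∏ j, (X - C (x j)) : R[X]).degree = n := by
      rw [degree_prod_X_sub_C, Finset.card_fin]
    refine (degree_sub_lt_left (hprod.trans (S.degree_eq n).symm)
      (monic_prod_X_sub_C x _).ne_zero ?_).trans_eq hprod
    rw [(monic_prod_X_sub_C x _).leadingCoeff, (hS n).leadingCoeff]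
  have hlower : ∀ i : Fin n, (monicBasis hS).repr (S n) i.rev = 0 := fun i => by
    rw [← monicBasis_apply hS, Module.Basis.repr_self, Finsupp.single_eq_of_ne i.rev.isLt.ne]
  have hsum := sum_repr_monicBasis hS hdeg
  simp only [map_sub, Finsupp.sub_apply, hlower, sub_zero] at hsum
  rw [monicOfCoords, add_comm, ← eq_sub_iff_add_eq]
  exact hsum

theorem rootCoords_eq_iff {x b : Fin n → R} :
    rootCoords hS x = b ↔ monicOfCoords S b = ∏ j, (X - C (x j)) := by
  refine ⟨fun h => h ▸ monicOfCoords_rootCoords hS x, fun h => funext fun i => ?_⟩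
  rw [rootCoords, ← h, repr_monicOfCoords]

theorem rootCoords_comp_perm (σ : Equiv.Perm (Fin n)) (x : Fin n → R) :
    rootCoords hS (x ∘ σ) = rootCoords hS x := by
  funext i
  simp only [rootCoords, Function.comp_apply, Equiv.prod_comp σ fun j => X - C (x j)]

theorem range_eq_range_of_rootCoords_eq {x y : Fin n → R} (h : rootCoords hS x = rootCoords hS y) :
    range x = range y := by
  have hroots : ∀ z : Fin n → R, range z = {t | (∏ j, (X - C (z j))).eval t = 0} := fun z => by
    ext t
    simp only [mem_range, Set.mem_ofPred_eq, eval_prod, eval_sub, eval_X, eval_C,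
      Finset.prod_eq_zero_iff, Finset.mem_univ, true_and, sub_eq_zero, eq_comm (a := t)]
  rw [hroots, hroots, ← monicOfCoords_rootCoords hS, h, monicOfCoords_rootCoords]

theorem injOn_rootCoords [LinearOrder R] : InjOn (rootCoords hS) {x : Fin n → R | StrictMono x} :=
  fun _ hx _ hy h => (StrictMono.range_inj hx hy).1 (range_eq_range_of_rootCoords_eq hS h)

end Coordinates

section Derivative

variable {𝕜 ι : Type*} [NontriviallyNormedField 𝕜] [Finite ι]

theorem differentiable_linearMap_prod_X_sub_C (s : Finset ι) (ℓ : 𝕜[X] →ₗ[𝕜] 𝕜) :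
    Differentiable 𝕜 fun x : ι → 𝕜 => ℓ (∏ j ∈ s, (X - C (x j))) := by
  classical
  have := Fintype.ofFinite ι
  induction s using Finset.induction_on generalizing ℓ with
  | empty => simp only [Finset.prod_empty, differentiable_const]
  | insert a s ha ih =>
    simp only [Finset.prod_insert ha, sub_mul, map_sub, C_mul', map_smul, smul_eq_mul]
    exact (ih (ℓ ∘ₗ LinearMap.mulLeft 𝕜 X)).sub ((differentiable_apply a).mul (ih ℓ))

theorem fderiv_linearMap_prod_X_sub_C_single [DecidableEq ι] {s : Finset ι} {i : ι} (hi : i ∈ s)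
    (ℓ : 𝕜[X] →ₗ[𝕜] 𝕜) (x : ι → 𝕜) :
    fderiv 𝕜 (fun x : ι → 𝕜 => ℓ (∏ j ∈ s, (X - C (x j)))) x (Pi.single i 1) =
      -ℓ (∏ j ∈ s.erase i, (X - C (x j))) := by
  have := Fintype.ofFinite ι
  have hline : HasDerivAt (fun t => ℓ (∏ j ∈ s, (X - C (Function.update x i t j))))
      (-ℓ (∏ j ∈ s.erase i, (X - C (x j)))) (x i) := by
    have herase : ∀ t, ∏ j ∈ s.erase i, (X - C (Function.update x i t j)) =
        ∏ j ∈ s.erase i, (X - C (x j)) := fun t => Finset.prod_congr rfl fun j hj => by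
      rw [Function.update_of_ne (Finset.ne_of_mem_erase hj)]
    simp only [← Finset.mul_prod_erase s _ hi, herase, Function.update_self, sub_mul, map_sub,
      C_mul', map_smul, smul_eq_mul]
    simpa using ((hasDerivAt_id' (x i)).mul_const _).const_sub _
  have hcomp := ((differentiable_linearMap_prod_X_sub_C s ℓ) (Function.update x i (x i))
    ).hasFDerivAt.comp_hasDerivAt (x i) (hasDerivAt_update x i (x i))
  rw [Function.update_eq_self] at hcomp
  exact hcomp.unique hline

end Derivative

section Jacobian

theorem abs_det_eval_rev {S : Sequence ℝ} (hS : ∀ i, (S i).Monic) {n : ℕ} (x : Fin n → ℝ) :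
    |(Matrix.of fun a k : Fin n => (S k.rev).eval (x a)).det| = absVandermonde x := by
  rw [absVandermonde, Matrix.det_eval_matrixOfPolynomials_eq_det_vandermonde x
    (fun i : Fin n => S i) (fun i => S.natDegree_eq i) fun i => hS i]
  exact Matrix.abs_det_submatrix_equiv_equiv (Equiv.refl _) Fin.revPerm
    (Matrix.of fun a k : Fin n => (S k).eval (x a))

variable {S : Sequence ℝ} (hS : ∀ i, (S i).Monic) {n : ℕ}

theorem differentiable_rootCoords : Differentiable ℝ (rootCoords hS : (Fin n → ℝ) → Fin n → ℝ) :=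
  differentiable_pi.2 fun i => differentiable_linearMap_prod_X_sub_C _ ((monicBasis hS).coord i.rev)

theorem fderiv_rootCoords_single (x : Fin n → ℝ) (i k : Fin n) :
    fderiv ℝ (rootCoords hS) x (Pi.single i 1) k =
      -(monicBasis hS).repr (∏ j ∈ Finset.univ.erase i, (X - C (x j))) k.rev := by
  exact (DFunLike.congr_fun (fderiv_apply (differentiable_rootCoords hS x) k) _).symm.trans
    (fderiv_linearMap_prod_X_sub_C_single (Finset.mem_univ i) ((monicBasis hS).coord k.rev) x)

theorem eval_mul_fderiv_rootCoords (x : Fin n → ℝ) :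
    (Matrix.of fun a k : Fin n => (S k.rev).eval (x a)) *
        LinearMap.toMatrix' (fderiv ℝ (rootCoords hS) x : (Fin n → ℝ) →ₗ[ℝ] Fin n → ℝ) =
      Matrix.diagonal fun i => -∏ j ∈ Finset.univ.erase i, (x i - x j) := by
  ext a i
  have hdeg : (∏ j ∈ Finset.univ.erase i, (X - C (x j)) : ℝ[X]).degree < n := by
    rw [degree_prod_X_sub_C, Nat.cast_lt]
    exact (Finset.card_erase_lt_of_mem (Finset.mem_univ i)).trans_eq (Finset.card_fin n)
  have heval := congrArg (eval (x a)) (sum_repr_monicBasis hS hdeg)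
  simp only [eval_finsetSum, eval_smul, smul_eq_mul, eval_prod, eval_sub, eval_X, eval_C] at heval
  simp only [Matrix.mul_apply, Matrix.of_apply, LinearMap.toMatrix'_apply,
    ContinuousLinearMap.coe_coe, fderiv_rootCoords_single, mul_comm (eval _ _), neg_mul,
    Finset.sum_neg_distrib, heval, Matrix.diagonal_apply]
  split_ifs with hai
  · rw [hai]
  · rw [Finset.prod_eq_zero (Finset.mem_erase.2 ⟨hai, Finset.mem_univ a⟩) (sub_self _), neg_zero]

theorem abs_det_fderiv_rootCoords {x : Fin n → ℝ} (hx : Function.Injective x) :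
    |(fderiv ℝ (rootCoords hS) x).det| = absVandermonde x := by
  have hdet := congrArg (|Matrix.det ·|) (eval_mul_fderiv_rootCoords hS x)
  simp only [Matrix.det_mul, Matrix.det_diagonal, abs_mul, LinearMap.det_toMatrix',
    abs_det_eval_rev hS, Finset.prod_neg, abs_pow, abs_neg, abs_one, one_pow, one_mul,
    ← absVandermonde_mul_self] at hdet
  exact mul_left_cancel₀ (absVandermonde_ne_zero hx) hdet

variable {K : Set (Fin n → ℝ)}

theorem volume_image_rootCoords_strictMono_inter
    (hK : ∀ σ : Equiv.Perm (Fin n), (· ∘ σ) ⁻¹' K = K) :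
    volume (rootCoords hS '' ({x | StrictMono x} ∩ K)) = volume (rootCoords hS '' K) := by
  refine (measure_mono (image_mono inter_subset_right)).antisymm ?_
  have hnull : volume (rootCoords hS '' {x : Fin n → ℝ | ¬Function.Injective x}) = 0 :=
    addHaar_image_eq_zero_of_differentiableOn_of_addHaar_eq_zero volume
      (differentiable_rootCoords hS).differentiableOn volume_setOf_not_injective
  rw [← add_zero (volume (rootCoords hS '' ({x | StrictMono x} ∩ K))), ← hnull]
  refine (measure_mono ?_).trans (measure_union_le _ _)
  rintro _ ⟨x, hx, rfl⟩
  by_cases hinj : Function.Injective x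
  · refine Or.inl ⟨x ∘ Tuple.sort x, ⟨strictMono_comp_sort hinj, ?_⟩, rootCoords_comp_perm hS _ x⟩
    rwa [← hK (Tuple.sort x)] at hx
  · exact Or.inr ⟨x, hinj, rfl⟩

theorem volume_image_rootCoords (hK : ∀ σ : Equiv.Perm (Fin n), (· ∘ σ) ⁻¹' K = K)
    (hm : MeasurableSet K) :
    volume (rootCoords hS '' K) =
      (∫⁻ x in K, ENNReal.ofReal (absVandermonde x)) / n.factorial := by
  have hmeas : MeasurableSet ({x : Fin n → ℝ | StrictMono x} ∩ K) :=
    measurableSet_strictMono.inter hm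
  have hfactorial : (n.factorial : ENNReal) ≠ 0 := mod_cast n.factorial_ne_zero
  rw [setLIntegral_eq_factorial_mul_strictMono hK (by fun_prop)
      fun σ x => by rw [absVandermonde_comp_perm], mul_comm,
    ENNReal.mul_div_cancel_right hfactorial (ENNReal.natCast_ne_top _),
    ← volume_image_rootCoords_strictMono_inter hS hK, ← lintegral_abs_det_fderiv_eq_addHaar_image
      volume hmeas (fun x _ => (differentiable_rootCoords hS x).hasFDerivAt.hasFDerivWithinAt)
      ((injOn_rootCoords hS).mono inter_subset_left)]
  refine setLIntegral_congr_fun hmeas fun x hx => ?_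
  simp only [abs_det_fderiv_rootCoords hS (StrictMono.injective hx.1)]

end Jacobian

end RootMap

section AddInv

open Polynomial in
theorem exists_add_inv_eq {K : Type*} [Field K] [IsAlgClosed K] (w : K) :
    ∃ z, z ≠ 0 ∧ z + z⁻¹ = w := by
  have hquad := isMonicOfDegree_sub_add_two w 1
  obtain ⟨z, hz⟩ := IsAlgClosed.exists_root (X ^ 2 - C w * X + C 1) <| by
    rw [degree_eq_natDegree hquad.ne_zero, hquad.natDegree_eq]
    norm_num
  simp only [IsRoot.def, eval_add, eval_sub, eval_mul, eval_pow, eval_X, eval_C] at hz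
  have hz0 : z ≠ 0 := by
    rintro rfl
    simp at hz
  refine ⟨z, hz0, ?_⟩
  field_simp
  linear_combination hz

theorem norm_eq_one_iff_exists_add_inv_eq {z : ℂ} (hz : z ≠ 0) :
    ‖z‖ = 1 ↔ ∃ t ∈ Icc (-2 : ℝ) 2, (t : ℂ) = z + z⁻¹ := by
  constructor
  · intro h
    have hre := abs_le.1 ((Complex.abs_re_le_norm z).trans_eq h)
    refine ⟨2 * z.re, ⟨by linarith, by linarith⟩, ?_⟩
    rw [Complex.inv_eq_conj h, Complex.add_conj]
  · rintro ⟨t, ht, h⟩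
    have hquad : z ^ 2 + 1 = t * z := by
      rw [h]
      field_simp
    have hconj : starRingEnd ℂ z ^ 2 + 1 = t * starRingEnd ℂ z := by
      simpa only [map_add, map_mul, map_pow, map_one, Complex.conj_ofReal] using
        congrArg (starRingEnd ℂ) hquad
    -- `z` and its conjugate are roots of `x ^ 2 - t * x + 1`, whose roots have product `1`.
    have hroots : (z - starRingEnd ℂ z) * (z * starRingEnd ℂ z - 1) = 0 := by
      linear_combination starRingEnd ℂ z * hquad - z * hconj
    rcases mul_eq_zero.1 hroots with hreal | hunit
    · obtain ⟨r, rfl⟩ := Complex.conj_eq_iff_real.1 (sub_eq_zero.1 hreal).symm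
      have hr : r ^ 2 + 1 = t * r := mod_cast hquad
      have habs : |r| ^ 2 + 1 ≤ 2 * |r| := by
        rw [sq_abs, hr]
        exact (le_abs_self _).trans_eq (abs_mul t r) |>.trans
          (mul_le_mul_of_nonneg_right (abs_le.2 ht) (abs_nonneg r))
      rw [Complex.norm_real, Real.norm_eq_abs]
      nlinarith [sq_nonneg (|r| - 1)]
    · rw [Complex.mul_conj', sub_eq_zero] at hunit
      exact (pow_eq_one_iff_of_nonneg (norm_nonneg z) two_ne_zero).1 (mod_cast hunit)

end AddInv

section RegionAsImage

open Polynomial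

theorem forall_root_mem_iff_exists_eq_prod_X_sub_C {K L : Type*} [Field K] [Field L]
    [IsAlgClosed L] [Algebra K L] {p : K[X]} {n : ℕ} (hp : IsMonicOfDegree p n) {s : Set K} :
    (∀ w : L, aeval w p = 0 → ∃ t ∈ s, algebraMap K L t = w) ↔
      ∃ x : Fin n → K, (∀ i, x i ∈ s) ∧ p = ∏ i, (X - C (x i)) := by
  constructor
  · intro h
    have hsplits : p.Splits := Splits.of_splits_map (algebraMap K L) (IsAlgClosed.splits _)
      fun w hw => by
        obtain ⟨t, -, rfl⟩ := h w (by rw [← eval_map_algebraMap]; exact (mem_roots'.1 hw).2)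
        exact ⟨t, rfl⟩
    obtain ⟨x, hx⟩ : ∃ x : Fin n → K, p.roots = Finset.univ.val.map x := by
      have hlength : p.roots.toList.length = n := by
        rw [Multiset.length_toList, ← hsplits.natDegree_eq_card_roots, hp.natDegree_eq]
      subst hlength
      exact ⟨p.roots.toList.get, by rw [Fin.univ_val_map, List.ofFn_get, Multiset.coe_toList]⟩
    refine ⟨x, fun i => ?_, ?_⟩
    · have hroot : x i ∈ p.roots := hx ▸ Multiset.mem_map_of_mem x (Finset.mem_univ_val i)
      obtain ⟨t, ht, hxt⟩ := h (algebraMap K L (x i)) <| by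
        rw [aeval_algebraMap_apply, coe_aeval_eq_eval, (mem_roots'.1 hroot).2, map_zero]
      rwa [← (algebraMap K L).injective hxt]
    · rw [hsplits.eq_prod_roots_of_monic hp.monic, hx, Multiset.map_map]
      rfl
  · rintro ⟨x, hx, rfl⟩ w hw
    rw [map_prod, Finset.prod_eq_zero_iff] at hw
    obtain ⟨i, -, hi⟩ := hw
    rw [map_sub, aeval_X, aeval_C, sub_eq_zero] at hi
    exact ⟨x i, hx i, hi.symm⟩

theorem isMonicOfDegree_dickson_succ {R : Type*} [CommRing R] [Nontrivial R] (k : ℕ) (a : R)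
    (n : ℕ) : IsMonicOfDegree (dickson k a (n + 1)) (n + 1) := by
  induction n using Nat.twoStepInduction with
  | zero => exact isMonicOfDegree_X R
  | one =>
    rw [dickson_two, sq]
    refine ((isMonicOfDegree_X R).mul (isMonicOfDegree_X R)).sub ?_
    have hconst : (3 - k : R[X]) = C (3 - k : R) := by
      rw [C_sub, map_natCast, map_ofNat]
    rw [hconst, ← C_mul, natDegree_C]
    exact Nat.zero_lt_two
  | more n ih₁ ih₂ =>
    rw [dickson_add_two, add_comm (n + 2)]
    refine ((isMonicOfDegree_X R).mul ih₂).sub ((natDegree_C_mul_le _ _).trans_lt ?_)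
    rw [ih₁.natDegree_eq]
    omega

/-- The sequence `1, C₁, C₂, …` of polynomials with `Cₖ (z + z⁻¹) = z ^ k + z⁻¹ ^ k` for `k ≥ 1`:
the Chebyshev polynomials of the first kind, rescaled to be monic. -/
noncomputable def chebyshevSequence : Sequence ℝ where
  elems'
    | 0 => 1
    | k + 1 => dickson 1 1 (k + 1)
  degree_eq'
    | 0 => degree_one
    | k + 1 => by
      have h := isMonicOfDegree_dickson_succ 1 (1 : ℝ) k
      rw [degree_eq_natDegree h.ne_zero, h.natDegree_eq]

theorem chebyshevSequence_zero : chebyshevSequence 0 = 1 := rfl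

theorem chebyshevSequence_succ (k : ℕ) : chebyshevSequence (k + 1) = dickson 1 1 (k + 1) := rfl

theorem chebyshevSequence_monic : ∀ k, (chebyshevSequence k).Monic
  | 0 => monic_one
  | k + 1 => (isMonicOfDegree_dickson_succ 1 1 k).monic

theorem aeval_chebyshevSequence_add_inv {L : Type*} [Field L] [Algebra ℝ L] {z : L} (hz : z ≠ 0)
    {k : ℕ} (hk : k ≠ 0) :
    aeval (z + z⁻¹) (chebyshevSequence k) = z ^ k + z⁻¹ ^ k := by
  obtain ⟨k, rfl⟩ := Nat.exists_eq_succ_of_ne_zero hk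
  rw [chebyshevSequence_succ, ← eval_map_algebraMap, map_dickson, map_one,
    dickson_one_one_eval_add_inv z z⁻¹ (mul_inv_cancel₀ hz)]

theorem aeval_palindromicPoly {n : ℕ} (hn : n ≠ 0) (b : Fin n → ℝ) {z : ℂ} (hz : z ≠ 0) :
    aeval z (palindromicPoly n b) =
      z ^ n * aeval (z + z⁻¹) (monicOfCoords chebyshevSequence b) := by
  have hpair : ∀ k l, z ^ (k + l) * (z ^ l + z⁻¹ ^ l) = z ^ (k + 2 * l) + z ^ k := fun k l => by
    rw [inv_pow, pow_add, mul_add, mul_assoc, mul_assoc, mul_inv_cancel₀ (pow_ne_zero l hz)]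
    ring
  simp only [palindromicPoly, monicOfCoords, map_add, map_sum, map_pow, aeval_X, map_one, map_smul,
    mul_add, Finset.mul_sum]
  congr 1
  · rw [aeval_chebyshevSequence_add_inv hz hn]
    simpa using (hpair 0 n).symm
  · refine Finset.sum_congr rfl fun i _ => ?_
    have hi := i.isLt
    rw [Fin.val_rev, Complex.real_smul]
    split_ifs with hmiddle
    · rw [hmiddle, Nat.sub_self, chebyshevSequence_zero]
      simp only [map_mul, map_pow, map_one, aeval_C, aeval_X, Complex.coe_algebraMap, mul_one]
      exact mul_comm _ _
    · have h := hpair (i + 1) (n - (i + 1))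
      rw [show (i : ℕ) + 1 + (n - (i + 1)) = n by omega,
        show (i : ℕ) + 1 + 2 * (n - (i + 1)) = 2 * n - (i + 1) by omega] at h
      rw [aeval_chebyshevSequence_add_inv hz (by omega), mul_left_comm, h]
      simp only [map_mul, map_add, map_pow, aeval_C, aeval_X, Complex.coe_algebraMap, mul_add]

theorem aeval_palindromicPoly_eq_zero_iff {n : ℕ} (b : Fin n → ℝ) {z : ℂ} (hz : z ≠ 0) :
    aeval z (palindromicPoly n b) = 0 ↔
      aeval (z + z⁻¹) (monicOfCoords chebyshevSequence b) = 0 := by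
  rcases eq_or_ne n 0 with rfl | hn
  · simp [palindromicPoly, monicOfCoords, chebyshevSequence_zero]
  · rw [aeval_palindromicPoly hn b hz, mul_eq_zero, or_iff_right (pow_ne_zero n hz)]

theorem aeval_zero_palindromicPoly_ne_zero {n : ℕ} (b : Fin n → ℝ) :
    aeval (0 : ℂ) (palindromicPoly n b) ≠ 0 := by
  rcases eq_or_ne n 0 with rfl | hn
  · simp [palindromicPoly]
  · have hsum : ∀ i : Fin n, 2 * n - ((i : ℕ) + 1) ≠ 0 := fun i => by omega
    simp [palindromicPoly, apply_ite, hn, hsum]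

theorem mem_unitCircleRegion_iff {n : ℕ} {b : Fin n → ℝ} :
    b ∈ unitCircleRegion n ↔ ∀ w : ℂ, aeval w (monicOfCoords chebyshevSequence b) = 0 →
      ∃ t ∈ Icc (-2 : ℝ) 2, (t : ℂ) = w := by
  constructor
  · intro h w hw
    obtain ⟨z, hz, rfl⟩ := exists_add_inv_eq w
    exact (norm_eq_one_iff_exists_add_inv_eq hz).1
      (h z ((aeval_palindromicPoly_eq_zero_iff b hz).2 hw))
  · intro h z hroot
    have hz : z ≠ 0 := by
      rintro rfl
      exact aeval_zero_palindromicPoly_ne_zero b hroot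
    exact (norm_eq_one_iff_exists_add_inv_eq hz).2
      (h _ ((aeval_palindromicPoly_eq_zero_iff b hz).1 hroot))

theorem unitCircleRegion_eq_image (n : ℕ) :
    unitCircleRegion n =
      rootCoords chebyshevSequence_monic '' Icc (fun _ : Fin n => -2) (fun _ => 2) := by
  ext b
  have hmonic : IsMonicOfDegree (monicOfCoords chebyshevSequence b) n :=
    ⟨natDegree_monicOfCoords b, monicOfCoords_monic chebyshevSequence_monic b⟩
  refine mem_unitCircleRegion_iff.trans <|
    (forall_root_mem_iff_exists_eq_prod_X_sub_C hmonic).trans ?_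
  simp only [mem_image, rootCoords_eq_iff, mem_Icc, Pi.le_def, forall_and]

end RegionAsImage

theorem integral_cube_absVandermonde (n : ℕ) :
    ∫ x in Icc (fun _ : Fin n => (-2 : ℝ)) (fun _ => 2), absVandermonde x =
      2 ^ (n * (n + 1)) *
        ∏ j ∈ Finset.Icc 1 n, ∏ i ∈ Finset.Ico 1 j, ((j : ℝ) - i) / (j + i) := by
  have hexponent : n * (n + 1) = 2 * (n + 1).choose 2 := by
    rw [mul_comm 2, ← Nat.add_one_mul_choose_eq, Nat.choose_one_right, mul_comm]
  rw [setIntegral_Icc_absVandermonde (by norm_num), hexponent, pow_mul]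
  norm_num

theorem proposition2p2p1 (n : ℕ) :
    MeasurableSet (unitCircleRegion n) ∧
    MeasureTheory.volume (unitCircleRegion n) =
      ENNReal.ofReal
        ((2 : ℝ) ^ (n * (n + 1)) / (n.factorial : ℝ) *
          ∏ j ∈ Finset.Icc 1 n, ∏ i ∈ Finset.Ico 1 j, ((j : ℝ) - (i : ℝ)) / ((j : ℝ) + (i : ℝ))) ∧
    (2 : ℝ) ^ (n * (n + 1)) / (n.factorial : ℝ) *
        ∏ j ∈ Finset.Icc 1 n, ∏ i ∈ Finset.Ico 1 j, ((j : ℝ) - (i : ℝ)) / ((j : ℝ) + (i : ℝ)) =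
      (2 : ℝ) ^ n / (n.factorial : ℝ) *
        ∏ j ∈ Finset.Icc 1 n, (2 * (j : ℝ) / (2 * (j : ℝ) - 1)) ^ (n + 1 - j) := by
  have hcontinuous := (differentiable_rootCoords chebyshevSequence_monic (n := n)).continuous
  have hintegrable : IntegrableOn absVandermonde (Icc (fun _ : Fin n => (-2 : ℝ)) fun _ => 2) :=
    continuous_absVandermonde.continuousOn.integrableOn_compact isCompact_Icc
  refine ⟨?_, ?_, ?_⟩
  · rw [unitCircleRegion_eq_image]
    exact (isCompact_Icc.image hcontinuous).measurableSet
  · rw [unitCircleRegion_eq_image, volume_image_rootCoords _ (preimage_comp_perm_Icc _ _)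
      measurableSet_Icc, ← ofReal_integral_eq_lintegral_ofReal hintegrable
      (.of_forall absVandermonde_nonneg), integral_cube_absVandermonde, div_mul_eq_mul_div,
      ENNReal.ofReal_div_of_pos (mod_cast n.factorial_pos), ENNReal.ofReal_natCast]
  · rw [div_mul_eq_mul_div, div_mul_eq_mul_div, two_pow_mul_prod_eq_prod_even_div_odd]
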